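/- Let $d\in\{2,3\}$ and let $\Omega\subset\mathbb R^d$ be a bounded domain with a conforming triangulation $\mathcal T_h$ into finitely many closed nondegenerate simplices. Let $A:\Omega\to\mathbb R^{d\times d}$ be measurable and symmetric with $a_{\min}|\xi|^2\le A(x)\xi\cdot\xi\le a_{\max}|\xi|^2$ for all $x\in\Omega$, $\xi\in\mathbb R^d$, where $a_{\min}>0$, and let $c^+\in L^\infty(\Omega)$, $c^+\ge 0$. For open $D\subset\Omega$ put $$a_D(u,v)=\int_D\big(A\nabla u\cdot\nabla v+c^+uv\big)\,dx,\qquad \|u\|_{a,D}=\sqrt{a_D(u,u)},\qquad \|u\|_a=\|u\|_{a,\Omega}.$$ Let $V^h\subset H^1_0(\Omega)$ be a conforming finite element space on $\mathcal T_h$, assembled from continuous shape functions with unisolvent local degrees of freedom, each attached to a face of the mesh (a vertex, an edge, ..., or a whole element), and let $\{\phi_i\}$ be its nodal basis. Partition $\mathcal T_h$ into $N$ nonoverlapping subdomains $\Omega_j'$, and extend each $\Omega'_j$ to $\Omega_j$ by adding elements of $\mathcal T_h$, among them at least all elements that share a degree of freedom of $V^h$ with an element of $\Omega_j'$. Let $\widetilde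 V_j=\{v|_{\Omega_j}:v\in V^h\}$, let $V_j\subset\widetilde V_j$ be the subspace of the functions vanishing on $\partial\Omega_j$ (those whose extension by zero lies in $V^h$), and let $R_j^\top:V_j\to V^h$ be the extension by zero. Let $\mathrm{dof}(\Omega_j)$ be the set of $i$ such that all elements carrying the degree of freedom $i$ belong to $\Omega_j$, let $\mu_i=\#\{j: i\in\mathrm{dof}(\Omega_j)\}$, and define $\Xi_j:\widetilde V_j\to V_j$ by $$\Xi_j\Big(\sum_i v_i\,\phi_i|_{\Omega_j}\Big)=\sum_{i\in\mathrm{dof}(\Omega_j)}\frac1{\mu_i}\,v_i\,\phi_i|_{\Omega_j}.$$ For each $j$ let $(p^j_l,\lambda^j_l)$, $l=1,\dots,\dim V_j$, be the finite eigenpairs, with $\lambda^j_1\le\lambda^j_2\le\cdots$ counted with multiplicity (the functions $\Xi_j(p^j_l)$, $l=1,\dots,\dim V_j$, are linearly independent), of the problem: find $p\in\widetilde V_j\setminus\{0\}$ and $\lambda\in\mathbb R$ with $$a_{\Omega_j}(p,v)=\lambda\,a_{\Omega_j}(\Xi_j(p),\Xi_j(v))\qquad\text{for all }v\in\widetilde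 V_j.$$ Let $m_j\in\{1,\dots,\dim V_j-1\}$ be such that $\lambda^j_{m_j+1}>0$ for every $j$, and set $$V_0=\operatorname{span}\{R_j^\top\Xi_j(p^j_l): 1\le l\le m_j,\ 1\le j\le N\},\qquad k_0=\max_{\tau\in\mathcal T_h}\#\{j:\tau\subset\overline{\Omega_j}\},\qquad \Theta=\Big(\min_{1\le j\le N}\lambda^j_{m_j+1}\Big)^{-1}.$$ Then, for every $v\in V^h$, $$\inf_{z\in V_0}\|v-z\|_a^2\le k_0^2\,\Theta\,\|v\|_a^2 .$$ -/

import Mathlib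

open MeasureTheory Set
open scoped ContDiff

noncomputable section

namespace GenEO

/-- Euclidean space `ℝ^d`. -/
abbrev E (d : ℕ) := EuclideanSpace ℝ (Fin d)

/-! ### Sobolev spaces -/

/-- `φ ∈ C_c^∞(D)`. -/
def IsTestFunction {d : ℕ} (D : Set (E d)) (φ : E d → ℝ) : Prop :=
  ContDiff ℝ ∞ φ ∧ HasCompactSupport φ ∧ tsupport φ ⊆ D

/-- `g ∈ L²(D)^d` is a weak gradient of `u` on `D`. -/
def IsWeakGradient {d : ℕ} (D : Set (E d)) (u : E d → ℝ) (g : E d → E d) : Prop :=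
  MemLp g 2 (volume.restrict D) ∧
    ∀ φ : E d → ℝ, IsTestFunction D φ → ∀ i : Fin d,
      ∫ x in D, u x * fderiv ℝ φ x (EuclideanSpace.single i 1) = - ∫ x in D, g x i * φ x

/-- `u ∈ H¹(D)`. -/
def MemH1 {d : ℕ} (D : Set (E d)) (u : E d → ℝ) : Prop :=
  MemLp u 2 (volume.restrict D) ∧ ∃ g, IsWeakGradient D u g

open scoped Classical in
/-- The weak gradient `∇u` on `D` of `u ∈ H¹(D)` (unique up to null sets). -/
def weakGrad {d : ℕ} (D : Set (E d)) (u : E d → ℝ) : E d → E d :=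
  if h : ∃ g, IsWeakGradient D u g then h.choose else 0

/-- `u ∈ H¹₀(D)`, the closure of `C_c^∞(D)` in `H¹(D)`. -/
def MemH10 {d : ℕ} (D : Set (E d)) (u : E d → ℝ) : Prop :=
  MemH1 D u ∧ ∀ ε : ENNReal, 0 < ε → ∃ φ, IsTestFunction D φ ∧
    eLpNorm (fun x => u x - φ x) 2 (volume.restrict D) ≤ ε ∧
    eLpNorm (fun x => weakGrad D u x - gradient φ x) 2 (volume.restrict D) ≤ ε

/-! ### The energy form -/

/-- `a_D(u, v) = ∫_D (A ∇u · ∇v + c⁺ u v) dx`. -/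
def energyForm {d : ℕ} (A : E d → Matrix (Fin d) (Fin d) ℝ) (cp : E d → ℝ) (D : Set (E d))
    (u v : E d → ℝ) : ℝ :=
  ∫ x in D, ((A x).mulVec (weakGrad D u x).ofLp ⬝ᵥ (weakGrad D v x).ofLp + cp x * u x * v x)

/-- `‖u‖_{a,D} = √a_D(u,u)`. -/
def energyNorm {d : ℕ} (A : E d → Matrix (Fin d) (Fin d) ℝ) (cp : E d → ℝ) (D : Set (E d))
    (u : E d → ℝ) : ℝ :=
  √(energyForm A cp D u u)

/-! ### Triangulations and finite element spaces -/

/-- A conforming triangulation of the open set `Ω` into finitely many nondegenerate closed `d`-simplices.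
Each simplex is given by its set of vertices. -/
structure Triangulation {d : ℕ} (Ω : Set (E d)) where
  isOpen : IsOpen Ω
  elems : Finset (Finset (E d))
  card_eq : ∀ t ∈ elems, t.card = d + 1
  indep : ∀ t ∈ elems, AffineIndependent ℝ (fun x : t => (x : E d))
  inter : ∀ s ∈ elems, ∀ t ∈ elems,
    convexHull ℝ (s : Set (E d)) ∩ convexHull ℝ (t : Set (E d))
      = convexHull ℝ ((s : Set (E d)) ∩ (t : Set (E d)))
  cover : ⋃ t ∈ elems, convexHull ℝ (t : Set (E d)) = closure Ω
  interior_subset : ∀ t ∈ elems, interior (convexHull ℝ (t : Set (E d))) ⊆ Ω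

/-- An `H¹₀(Ω)`-conforming finite element space on a triangulation, in the sense of Ciarlet.
`ι` is the set of all global degrees of freedom, including those fixed by the boundary condition.
* Each degree of freedom `i` sits on a face of the mesh (a vertex, an edge, ..., a whole element),
  whose set of vertices is `site i`; the degrees of freedom of the element `t` are those with
  `site i ⊆ t`.
* `shape t` is the local space of shape functions on the closed simplex `t`, and `nodal t` maps a
  shape function to the values of the degrees of freedom of `t`; unisolvence is its bijectivity.
* `free` is the set of degrees of freedom that are not set to zero by the boundary condition.
* Conformity: each vector of values of the free degrees of freedom is assembled to a function in
  `H¹₀(Ω)` (extended by zero outside `Ω`). -/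
structure FESpace {d : ℕ} {Ω : Set (E d)} (T : Triangulation Ω) (ι : Type*) where
  site : ι → Finset (E d)
  site_nonempty : ∀ i, (site i).Nonempty
  site_subset : ∀ i, ∃ t ∈ T.elems, site i ⊆ t
  shape : ∀ t : T.elems, Submodule ℝ C(convexHull ℝ ((t : Finset (E d)) : Set (E d)), ℝ)
  nodal : ∀ t : T.elems, shape t ≃ₗ[ℝ] ({i : ι // site i ⊆ t} → ℝ)
  free : Finset ι
  conforming : ∀ c : ι → ℝ, (∀ i, i ∉ free → c i = 0) →
    ∃ v : E d → ℝ, (∀ x, x ∉ Ω → v x = 0) ∧ MemH10 Ω v ∧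
      ∀ (t : T.elems) (x : convexHull ℝ ((t : Finset (E d)) : Set (E d))),
        v x = ((nodal t).symm (fun i => c i)).1 x

namespace FESpace

variable {d : ℕ} {Ω : Set (E d)} {T : Triangulation Ω} {ι : Type*}

/-- `v` is the finite element function whose vector of degrees of freedom is `c`. -/
def HasDofs (F : FESpace T ι) (c : ι → ℝ) (v : E d → ℝ) : Prop :=
  (∀ i, i ∉ F.free → c i = 0) ∧ (∀ x, x ∉ Ω → v x = 0) ∧
    ∀ (t : T.elems) (x : convexHull ℝ ((t : Finset (E d)) : Set (E d))),
      v x = ((F.nodal t).symm (fun i => c i)).1 x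

theorem HasDofs.add {F : FESpace T ι} {c c' : ι → ℝ} {v v' : E d → ℝ}
    (h : F.HasDofs c v) (h' : F.HasDofs c' v') : F.HasDofs (c + c') (v + v') := by
  refine ⟨fun i hi => by simp [h.1 i hi, h'.1 i hi],
    fun x hx => by simp [h.2.1 x hx, h'.2.1 x hx], fun t x => ?_⟩
  have : (fun i : {i : ι // F.site i ⊆ t} => (c + c') i)
      = (fun i : {i : ι // F.site i ⊆ t} => c i) + (fun i : {i : ι // F.site i ⊆ t} => c' i) := rfl
  rw [this, map_add]
  simp [h.2.2 t x, h'.2.2 t x]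

theorem HasDofs.smul {F : FESpace T ι} {c : ι → ℝ} {v : E d → ℝ} (r : ℝ)
    (h : F.HasDofs c v) : F.HasDofs (r • c) (r • v) := by
  refine ⟨fun i hi => by simp [h.1 i hi], fun x hx => by simp [h.2.1 x hx], fun t x => ?_⟩
  have : (fun i : {i : ι // F.site i ⊆ t} => (r • c) i)
      = r • (fun i : {i : ι // F.site i ⊆ t} => c i) := rfl
  rw [this, map_smul]
  simp [h.2.2 t x]

theorem hasDofs_zero (F : FESpace T ι) : F.HasDofs 0 0 := by
  refine ⟨fun i _ => rfl, fun x _ => rfl, fun t x => ?_⟩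
  have : (fun i : {i : ι // F.site i ⊆ t} => (0 : ι → ℝ) i) = 0 := rfl
  rw [this, map_zero]
  simp

/-- The finite element space `V^h`. -/
def space (F : FESpace T ι) : Submodule ℝ (E d → ℝ) where
  carrier := {v | ∃ c, F.HasDofs c v}
  add_mem' := fun ⟨_, h⟩ ⟨_, h'⟩ => ⟨_, h.add h'⟩
  zero_mem' := ⟨0, F.hasDofs_zero⟩
  smul_mem' := fun r _ ⟨_, h⟩ => ⟨_, h.smul r⟩

open scoped Classical in
theorem exists_basisFun (F : FESpace T ι) (i : F.free) :
    ∃ v, F.HasDofs (Pi.single (i : ι) (1 : ℝ)) v := by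
  have h0 : ∀ k, k ∉ F.free → (Pi.single (i : ι) (1 : ℝ) : ι → ℝ) k = 0 := fun k hk =>
    Pi.single_eq_of_ne (fun h => hk (by rw [h]; exact i.2)) _
  obtain ⟨v, h1, -, h2⟩ := F.conforming _ h0
  exact ⟨v, h0, h1, h2⟩

/-- The nodal basis function `φ_i` of `V^h`. -/
def basisFun (F : FESpace T ι) (i : F.free) : E d → ℝ := (F.exists_basisFun i).choose

open scoped Classical in
theorem basisFun_hasDofs (F : FESpace T ι) (i : F.free) :
    F.HasDofs (Pi.single (i : ι) (1 : ℝ)) (F.basisFun i) := (F.exists_basisFun i).choose_spec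

theorem HasDofs.sum {F : FESpace T ι} {κ : Type*} (s : Finset κ) (c : κ → ι → ℝ)
    (v : κ → E d → ℝ) (h : ∀ k ∈ s, F.HasDofs (c k) (v k)) :
    F.HasDofs (∑ k ∈ s, c k) (∑ k ∈ s, v k) := by
  classical
  induction s using Finset.induction_on with
  | empty => simpa using F.hasDofs_zero
  | insert a s ha ih =>
    rw [Finset.sum_insert ha, Finset.sum_insert ha]
    exact (h a (Finset.mem_insert_self a s)).add
      (ih fun k hk => h k (Finset.mem_insert_of_mem hk))

theorem HasDofs.eq_zero_of_interior {F : FESpace T ι} {c : ι → ℝ} {v : E d → ℝ}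
    (h : F.HasDofs c v) {t : Finset (E d)} (ht : t ∈ T.elems)
    (h0 : ∀ x ∈ interior (convexHull ℝ (t : Set (E d))), v x = 0) {i : ι}
    (hi : F.site i ⊆ t) : c i = 0 := by
  have hne : (interior (convexHull ℝ (t : Set (E d)))).Nonempty := by
    rw [interior_convexHull_nonempty_iff_affineSpan_eq_top]
    have := (T.indep t ht).affineSpan_eq_top_iff_card_eq_finrank_add_one
    rw [Subtype.range_coe_subtype] at this
    refine this.2 ?_
    simp [T.card_eq t ht]
  have hd := (convex_convexHull ℝ (t : Set (E d))).closure_interior_eq_closure_of_nonempty_interior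
    hne
  set q := ((F.nodal ⟨t, ht⟩).symm (fun i => c i)).1 with hq
  have hq0 : q = 0 := by
    ext x
    have hx : (x : E d) ∈ closure (interior (convexHull ℝ (t : Set (E d)))) := by
      rw [hd]; exact subset_closure x.2
    have hx' : x ∈ closure ((↑) ⁻¹' (interior (convexHull ℝ (t : Set (E d)))) :
        Set (convexHull ℝ (t : Set (E d)))) := by
      rw [closure_subtype, Subtype.image_preimage_coe,
        Set.inter_eq_right.2 interior_subset]
      exact hx
    have hcl : IsClosed {y | q y = 0} := isClosed_eq q.continuous continuous_const
    refine hcl.closure_subset_iff.2 (fun y hy => ?_) hx'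
    exact (h.2.2 ⟨t, ht⟩ y).symm.trans (h0 y hy)
  have h1 : (F.nodal ⟨t, ht⟩).symm (fun i => c i) = 0 := Subtype.ext hq0
  have h2 := (F.nodal ⟨t, ht⟩).symm.map_eq_zero_iff.1 h1
  exact congrFun h2 ⟨i, hi⟩

open scoped Classical in
/-- The elements that share a free degree of freedom with an element of `S`. -/
def layer (F : FESpace T ι) (S : Finset (Finset (E d))) : Finset (Finset (E d)) :=
  T.elems.filter (fun t => ∃ i ∈ F.free, F.site i ⊆ t ∧ ∃ s ∈ S, F.site i ⊆ s)

end FESpace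

/-! ### Overlapping decompositions -/

/-- An overlapping decomposition of `Ω` into `N` subdomains: `core j` is the set of elements of the
nonoverlapping subdomain `Ω'_j`; `ext j` is the set of elements of `Ω_j`, which arises
from `Ω'_j` by adding at least one layer of adjoining elements. -/
structure Decomposition {d : ℕ} {Ω : Set (E d)} {T : Triangulation Ω} {ι : Type*}
    (F : FESpace T ι) (N : ℕ) where
  core : Fin N → Finset (Finset (E d))
  ext : Fin N → Finset (Finset (E d))
  core_disjoint : ∀ j k, j ≠ k → Disjoint (core j) (core k)
  core_cover : ∀ t, t ∈ T.elems ↔ ∃ j, t ∈ core j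
  core_subset : ∀ j, core j ⊆ ext j
  layer_subset : ∀ j, F.layer (core j) ⊆ ext j
  ext_subset : ∀ j, ext j ⊆ T.elems

/-- Restriction to `D`, where a function on `D` is represented by its extension by zero. -/
def restrictTo {d : ℕ} (D : Set (E d)) : (E d → ℝ) →ₗ[ℝ] (E d → ℝ) where
  toFun u := D.indicator u
  map_add' u v := Set.indicator_add D u v
  map_smul' r u := Set.indicator_const_smul D r u

namespace Decomposition

variable {d N : ℕ} {Ω : Set (E d)} {T : Triangulation Ω} {ι : Type*} {F : FESpace T ι}

/-- The subdomain `Ω_j`. -/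
def sub (D : Decomposition F N) (j : Fin N) : Set (E d) :=
  Ω ∩ interior (⋃ t ∈ D.ext j, convexHull ℝ (t : Set (E d)))

/-- `k₀`, the maximal number of subdomains an element belongs to. -/
def k0 (D : Decomposition F N) : ℕ := by
  classical
  exact T.elems.sup (fun t => (Finset.univ.filter (fun j => t ∈ D.ext j)).card)

/-- `Ṽ_j = {v|_{Ω_j} : v ∈ V^h}`. -/
def Vt (D : Decomposition F N) (j : Fin N) : Submodule ℝ (E d → ℝ) :=
  F.space.map (restrictTo (D.sub j))

/-- `V_j`: the functions in `Ṽ_j` that vanish on `∂Ω_j`, that is, those whose extension by zero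
belongs to `V^h`. As functions on `Ω_j` are represented by their extension by zero,
the extension operator `R_jᵀ : V_j → V^h` is the inclusion. -/
def V (D : Decomposition F N) (j : Fin N) : Submodule ℝ (E d → ℝ) := D.Vt j ⊓ F.space

/-- The free degrees of freedom of `Ω_j`, which index the nodal basis of `Ṽ_j`. -/
def dofs (D : Decomposition F N) (j : Fin N) : Set F.free :=
  {i | ∃ t ∈ D.ext j, F.site i ⊆ t}

/-- `dof(Ω_j)`, the internal degrees of freedom of `Ω_j`: all elements that carry `i` lie in
`Ω_j`. -/
def intDofs (D : Decomposition F N) (j : Fin N) : Set F.free :=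
  {i | ∀ t ∈ T.elems, F.site i ⊆ t → t ∈ D.ext j}

theorem intDofs_subset (D : Decomposition F N) (j : Fin N) : D.intDofs j ⊆ D.dofs j := by
  intro i hi
  obtain ⟨t, ht, hit⟩ := F.site_subset i
  exact ⟨t, hi t ht hit, hit⟩

/-- `φ_i^j = φ_i|_{Ω_j}`. -/
def localFun (D : Decomposition F N) (j : Fin N) (i : D.dofs j) : D.Vt j :=
  ⟨restrictTo (D.sub j) (F.basisFun i),
    Submodule.mem_map_of_mem ⟨_, F.basisFun_hasDofs i⟩⟩

theorem interior_subset_sub (D : Decomposition F N) (j : Fin N) {t : Finset (E d)}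
    (ht : t ∈ D.ext j) : interior (convexHull ℝ (t : Set (E d))) ⊆ D.sub j :=
  fun _ hx => ⟨T.interior_subset t (D.ext_subset j ht) hx,
    interior_mono (Set.subset_biUnion_of_mem (u := fun t : Finset (E d) =>
      convexHull ℝ (t : Set (E d))) ht) hx⟩

open scoped Classical in
theorem hasDofs_combo [Fintype ι] {S : Set F.free} (g : S → ℝ) :
    F.HasDofs (fun k => if h : ∃ hk : k ∈ F.free, (⟨k, hk⟩ : F.free) ∈ S
      then g ⟨⟨k, h.1⟩, h.2⟩ else 0) (∑ i : S, g i • F.basisFun i) := by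
  have h := FESpace.HasDofs.sum (F := F) (Finset.univ : Finset S)
    (fun i => g i • (Pi.single ((i : F.free) : ι) (1 : ℝ) : ι → ℝ)) (fun i => g i • F.basisFun i)
    (fun i _ => (F.basisFun_hasDofs i).smul (g i))
  convert h using 1
  funext k
  rw [Finset.sum_apply]
  split_ifs with hk
  · rw [Finset.sum_eq_single (⟨⟨k, hk.1⟩, hk.2⟩ : S)]
    · simp
    · intro b _ hb
      have : k ≠ ((b : F.free) : ι) := fun h => hb (by ext; exact h.symm)
      simp [this]
    · simp
  · symm
    refine Finset.sum_eq_zero fun b _ => ?_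
    have : k ≠ ((b : F.free) : ι) := by
      rintro rfl
      exact hk ⟨b.1.2, b.2⟩
    simp [this]

theorem localFun_linearIndependent [Fintype ι] (D : Decomposition F N) (j : Fin N) :
    LinearIndependent ℝ (D.localFun j) := by
  classical
  rw [Fintype.linearIndependent_iff]
  intro g hg i
  have hc := hasDofs_combo (F := F) (S := D.dofs j) g
  obtain ⟨t, ht, hit⟩ := i.2
  have h0 : ∀ x ∈ interior (convexHull ℝ (t : Set (E d))),
      (∑ i : D.dofs j, g i • F.basisFun i) x = 0 := by
    intro x hx
    have h1 := congrArg (fun w : D.Vt j => (w : E d → ℝ) x) hg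
    simpa [localFun, restrictTo, Set.indicator_of_mem (D.interior_subset_sub j ht hx)] using h1
  have := hc.eq_zero_of_interior (D.ext_subset j ht) h0 hit
  rw [dif_pos ⟨i.1.2, i.2⟩] at this
  exact this

theorem top_le_span_localFun [Fintype ι] (D : Decomposition F N) (j : Fin N) :
    ⊤ ≤ Submodule.span ℝ (Set.range (D.localFun j)) := by
  classical
  rintro ⟨w, u, ⟨c, hc⟩, rfl⟩ -
  have hS := hasDofs_combo (F := F) (S := D.dofs j) (fun i => c (i : F.free))
  have : (⟨restrictTo (D.sub j) u, Submodule.mem_map_of_mem ⟨c, hc⟩⟩ : D.Vt j)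
      = ∑ i : D.dofs j, c (i : F.free) • D.localFun j i := by
    ext x
    by_cases hx : x ∈ D.sub j
    · obtain ⟨t, ht, hxt⟩ := Set.mem_iUnion₂.1 (interior_subset hx.2)
      have e1 := hc.2.2 ⟨t, D.ext_subset j ht⟩ ⟨x, hxt⟩
      have e2 := hS.2.2 ⟨t, D.ext_subset j ht⟩ ⟨x, hxt⟩
      have e3 : (fun i : {i : ι // F.site i ⊆ t} => c i) = (fun i : {i : ι // F.site i ⊆ t} =>
          if h : ∃ hk : (i : ι) ∈ F.free, (⟨i, hk⟩ : F.free) ∈ D.dofs j then c i else 0) := by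
        funext i
        split_ifs with h
        · rfl
        · exact hc.1 i fun hi => h ⟨hi, t, ht, i.2⟩
      have e4 : u x = (∑ i : D.dofs j, c (i : F.free) • F.basisFun i) x := by
        rw [e1, e2]; simp only [e3]
      simpa [localFun, restrictTo, Set.indicator_of_mem hx] using e4
    · simp [localFun, restrictTo, Set.indicator_of_notMem hx]
  rw [this]
  exact Submodule.sum_mem _ fun i _ =>
    Submodule.smul_mem _ _ (Submodule.subset_span (Set.mem_range_self i))

/-- The nodal basis `(φ_i^j)_i` of `Ṽ_j`. -/
def nodalBasis [Fintype ι] (D : Decomposition F N) (j : Fin N) :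
    Module.Basis (D.dofs j) ℝ (D.Vt j) :=
  Module.Basis.mk (D.localFun_linearIndependent j) (D.top_le_span_localFun j)

/-- `μ_i`, the number of subdomains for which `i` is an internal degree of freedom. -/
def mu (D : Decomposition F N) (i : F.free) : ℕ := Nat.card {j : Fin N // i ∈ D.intDofs j}

theorem localFun_mem_V (D : Decomposition F N) (j : Fin N) (i : D.dofs j)
    (hi : (i : F.free) ∈ D.intDofs j) : (D.localFun j i : E d → ℝ) ∈ D.V j := by
  classical
  refine ⟨(D.localFun j i).2, ?_⟩
  have h := F.basisFun_hasDofs i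
  have : (D.localFun j i : E d → ℝ) = F.basisFun i := by
    refine Set.indicator_eq_self.2 fun x hx => ?_
    have hxΩ : x ∈ Ω := by
      by_contra hxΩ
      exact hx (h.2.1 x hxΩ)
    have hout : ∀ t ∈ T.elems, t ∉ D.ext j → x ∉ convexHull ℝ (t : Set (E d)) := by
      intro t ht htj hxt
      refine hx ((h.2.2 ⟨t, ht⟩ ⟨x, hxt⟩).trans ?_)
      have : (fun k : {k : ι // F.site k ⊆ t} =>
          (Pi.single ((i : F.free) : ι) (1 : ℝ) : ι → ℝ) k) = 0 := by
        funext k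
        refine Pi.single_eq_of_ne (fun hk => htj (hi t ht ?_)) _
        rw [← hk]
        exact k.2
      rw [this, map_zero]
      rfl
    refine ⟨hxΩ, ?_⟩
    have hclosed : IsClosed (⋃ t ∈ T.elems \ D.ext j, convexHull ℝ (t : Set (E d))) :=
      isClosed_biUnion_finset fun t _ => (t.finite_toSet.isCompact_convexHull ℝ).isClosed
    by_contra hxi
    have hint : interior (closure Ω) ∩
        (⋃ t ∈ T.elems \ D.ext j, convexHull ℝ (t : Set (E d)))ᶜ ⊆
        interior (⋃ t ∈ D.ext j, convexHull ℝ (t : Set (E d))) := by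
      refine interior_maximal ?_ (isOpen_interior.inter hclosed.isOpen_compl)
      rintro y ⟨hy, hy'⟩
      have hy2 := interior_subset hy
      rw [← T.cover] at hy2
      obtain ⟨t, ht, hyt⟩ := Set.mem_iUnion₂.1 hy2
      by_cases htj : t ∈ D.ext j
      · exact Set.mem_iUnion₂.2 ⟨t, htj, hyt⟩
      · exact absurd (Set.mem_iUnion₂.2 ⟨t, Finset.mem_sdiff.2 ⟨ht, htj⟩, hyt⟩) hy'
    refine hxi (hint ⟨?_, ?_⟩)
    · exact interior_maximal subset_closure T.isOpen hxΩ
    · intro hxu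
      obtain ⟨t, ht, hxt⟩ := Set.mem_iUnion₂.1 hxu
      exact hout t (Finset.mem_sdiff.1 ht).1 (Finset.mem_sdiff.1 ht).2 hxt
  rw [this]
  exact ⟨_, h⟩

open scoped Classical in
/-- The local partition of unity operator `Ξ_j : Ṽ_j → V_j`,
`Ξ_j(∑ v_i φ_i^j) = ∑_{i ∈ dof(Ω_j)} (1 / μ_i) v_i φ_i^j`. -/
def Xi [Fintype ι] (D : Decomposition F N) (j : Fin N) : D.Vt j →ₗ[ℝ] D.V j :=
  ∑ i : D.dofs j, if hi : (i : F.free) ∈ D.intDofs j then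
    ((1 / (D.mu i : ℝ)) • (D.nodalBasis j).coord i).smulRight
      (⟨D.localFun j i, D.localFun_mem_V j i hi⟩ : D.V j) else 0

/-! ### The GenEO eigenproblems and coarse space -/

/-- `(p, lam)` is an eigenpair of the generalized eigenproblem on `Ω_j`: `p ≠ 0` and
`a_{Ω_j}(p, v) = lam a_{Ω_j}(Ξ_j p, Ξ_j v)` for all `v ∈ Ṽ_j`. -/
def IsEigenpair [Fintype ι] (D : Decomposition F N) (A : E d → Matrix (Fin d) (Fin d) ℝ)
    (cp : E d → ℝ) (j : Fin N) (p : D.Vt j) (lam : ℝ) : Prop :=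
  p ≠ 0 ∧ ∀ v : D.Vt j,
    energyForm A cp (D.sub j) p v = lam * energyForm A cp (D.sub j) (D.Xi j p) (D.Xi j v)

/-- `(p_l, lam_l)`, `l = 1, ..., dim V_j`, are the (finite) eigenpairs of the generalized
eigenproblem on `Ω_j`, in nondecreasing order and counted with multiplicity.
The eigenfunctions are linearly independent modulo the kernel of `Ξ_j`
(which carries the infinite eigenvalues); they need not be normalized. -/
def IsEigensystem [Fintype ι] (D : Decomposition F N) (A : E d → Matrix (Fin d) (Fin d) ℝ)
    (cp : E d → ℝ) (j : Fin N) (p : Fin (Module.finrank ℝ (D.V j)) → D.Vt j)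
    (lam : Fin (Module.finrank ℝ (D.V j)) → ℝ) : Prop :=
  (∀ l, D.IsEigenpair A cp j (p l) (lam l)) ∧ Monotone lam ∧
    LinearIndependent ℝ (fun l => D.Xi j (p l))

/-- The GenEO coarse space `V_0 = span {R_jᵀ Ξ_j(p_l^j) : 1 ≤ l ≤ m_j, 1 ≤ j ≤ N}`. -/
def coarseSpace [Fintype ι] (D : Decomposition F N)
    (p : ∀ j, Fin (Module.finrank ℝ (D.V j)) → D.Vt j) (m : Fin N → ℕ) :
    Submodule ℝ (E d → ℝ) :=
  Submodule.span ℝ {w | ∃ j, ∃ l : Fin (Module.finrank ℝ (D.V j)),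
    (l : ℕ) < m j ∧ w = (D.Xi j (p j l) : E d → ℝ)}

end Decomposition

end GenEO

end

/-!
The estimate is a spectral one on each subdomain, glued together by a partition of unity.

On `Ω_j` put `a = a_{Ω_j}` and `b(u, v) = a_{Ω_j}(Ξ_j u, Ξ_j v)`. Since the `Ξ_j p_l` form a basis of
`V_j`, the restriction `v_j` of `v` is a combination of the `p_l` plus an element of `ker Ξ_j`, and
the latter is `a`-orthogonal to all eigenfunctions. Let `z_j` be the `b`-projection of that
combination onto the span of the first `m_j` eigenfunctions. Then `v_j - z_j` is both `a`- and
`b`-orthogonal to this span, whence `λ_{m_j+1} b(v_j - z_j, v_j - z_j) ≤ a(v_j, v_j)`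
(`exists_mem_span_mul_apply_sub_le`). A projection rather than a truncated expansion is needed
because eigenfunctions of one eigenvalue need not be orthogonal, and that eigenvalue may be cut at
`m_j`.

Each degree of freedom is internal to some subdomain, so `∑_j R_jᵀ Ξ_j v_j = v`
(`Decomposition.sum_Xi_restr`), and with `z = ∑_j R_jᵀ Ξ_j z_j ∈ V_0` the error is
`v - z = ∑_j R_jᵀ Ξ_j (v_j - z_j)`. Almost every point of `Ω` is interior to an element and hence
lies in at most `k₀` subdomains. This costs one factor `k₀` in bounding the energy of the sum by the
local energies (`Decomposition.energyForm_sum_le`) and another in bounding the sum of the local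
energies of `v` by its global energy (`Decomposition.sum_energyForm_restr_le`). The comparison of
local and global energies rests on the uniqueness of weak gradients on open sets
(`IsWeakGradient.ae_eq`).
-/

namespace GenEO

/-! ### Spectral truncation for a pair of semidefinite forms -/

theorem apply_eq_zero_of_apply_self_eq_zero {V : Type*} [AddCommGroup V] [Module ℝ V]
    (b : LinearMap.BilinForm ℝ V) (hs : ∀ x y, b x y = b y x) (hb : ∀ x, 0 ≤ b x x) {e : V}
    (he : b e e = 0) (y : V) : b e y = 0 := by
  have h := LinearMap.BilinForm.apply_sq_le_of_symm b hb ⟨hs⟩ e y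
  rw [he, zero_mul] at h
  exact pow_eq_zero_iff two_ne_zero |>.1 (le_antisymm h (sq_nonneg _))

/-- Orthogonal projection onto the span of finitely many vectors for a form that is merely
semidefinite; existence survives because null vectors are orthogonal to everything. -/
theorem exists_mem_span_forall_apply_sub_eq_zero {V : Type*} [AddCommGroup V] [Module ℝ V]
    (b : LinearMap.BilinForm ℝ V) (hs : ∀ x y, b x y = b y x) (hb : ∀ x, 0 ≤ b x x)
    {s : Set V} (hfin : s.Finite) (x : V) :
    ∃ z ∈ Submodule.span ℝ s, ∀ w ∈ Submodule.span ℝ s, b w (x - z) = 0 := by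
  induction s, hfin using Set.Finite.induction_on generalizing x with
  | empty => exact ⟨0, zero_mem _, fun w hw => by
      rw [Submodule.span_empty, Submodule.mem_bot] at hw; simp [hw]⟩
  | @insert a s _ _ ih =>
    obtain ⟨z, hz, hzw⟩ := ih x
    obtain ⟨a', ha', haw⟩ := ih a
    have hle : Submodule.span ℝ s ≤ Submodule.span ℝ (insert a s) :=
      Submodule.span_mono (subset_insert a s)
    have hae : a - a' ∈ Submodule.span ℝ (insert a s) :=
      sub_mem (Submodule.subset_span (mem_insert a s)) (hle ha')
    -- The Gram–Schmidt step along `a - a'`; if `a - a'` is null, the division by zero returns the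
    -- correct coefficient `0`.
    set r := b (a - a') (x - z) / b (a - a') (a - a')
    refine ⟨z + r • (a - a'), add_mem (hle hz) (Submodule.smul_mem _ _ hae), fun w hw => ?_⟩
    obtain ⟨q, w', hw', rfl⟩ := Submodule.mem_span_insert.1 hw
    have e1 : x - (z + r • (a - a')) = (x - z) - r • (a - a') := by abel
    have e2 : q • a + w' = q • (a - a') + (q • a' + w') := by rw [smul_sub]; abel
    have h3 : q • a' + w' ∈ Submodule.span ℝ s := add_mem (Submodule.smul_mem _ _ ha') hw'
    have key : b (a - a') ((x - z) - r • (a - a')) = 0 := by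
      rw [map_sub, map_smul, smul_eq_mul]
      by_cases h0 : b (a - a') (a - a') = 0
      · rw [apply_eq_zero_of_apply_self_eq_zero b hs hb h0, h0]; simp
      · rw [div_mul_cancel₀ _ h0, sub_self]
    rw [e1, e2, map_add, LinearMap.add_apply, map_smul, LinearMap.smul_apply, key, map_sub (b _),
      map_smul (b _) r, hzw _ h3, haw _ h3]
    simp

/-- A combination `r` of eigenvectors that is `b`-orthogonal to those below `lam m` satisfies
`lam m * b r r ≤ a r r`. Eigenvectors within a multiple eigenvalue need not be orthogonal, nor need
the eigenvalue be cut at the boundary of a cluster. -/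
theorem mul_apply_self_le_of_orthogonal {V : Type*} [AddCommGroup V] [Module ℝ V]
    (a b : LinearMap.BilinForm ℝ V) (has : ∀ x y, a x y = a y x) (hs : ∀ x y, b x y = b y x)
    (hb : ∀ x, 0 ≤ b x x) {n : ℕ} (p : Fin n → V) (lam : Fin n → ℝ) (hmono : Monotone lam)
    (hp : ∀ l v, a (p l) v = lam l * b (p l) v) (m : Fin n) (β : Fin n → ℝ)
    (hr : ∀ l, l < m → b (p l) (∑ k, β k • p k) = 0) :
    lam m * b (∑ k, β k • p k) (∑ k, β k • p k) ≤ a (∑ k, β k • p k) (∑ k, β k • p k) := by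
  set r := ∑ k, β k • p k with hrdef
  set c : Fin n → ℝ := fun l => max (lam l - lam m) 0 with hc
  have horth : ∀ l k, lam l ≠ lam k → b (p l) (p k) = 0 := by
    intro l k hlk
    have h1 := hp l (p k)
    rw [has, hp k, hs (p k)] at h1
    have h2 : (lam l - lam k) * b (p l) (p k) = 0 := by linarith
    exact (mul_eq_zero.1 h2).resolve_left (sub_ne_zero.2 hlk)
  have hexp : ∀ (f : LinearMap.BilinForm ℝ V) y, f r y = ∑ l, β l * f (p l) y := by
    intro f y; simp [hrdef, LinearMap.sum_apply]
  have h1 : a r r - lam m * b r r = ∑ l, β l * (c l * b (p l) r) := by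
    rw [hexp a, hexp b, Finset.mul_sum, ← Finset.sum_sub_distrib]
    refine Finset.sum_congr rfl fun l _ => ?_
    rw [hp]
    by_cases hl : l < m
    · rw [hr l hl]; ring
    · have : c l = lam l - lam m := max_eq_left (sub_nonneg.2 (hmono (not_lt.1 hl)))
      rw [this]; ring
  -- As `b` couples only equal eigenvalues, the weight `c l` splits as `√(c l) * √(c k)`.
  have h2 : ∑ l, β l * (c l * b (p l) r)
      = b (∑ l, (√(c l) * β l) • p l) (∑ l, (√(c l) * β l) • p l) := by
    simp only [map_sum, LinearMap.sum_apply, map_smul, LinearMap.smul_apply, smul_eq_mul, hrdef,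
      Finset.mul_sum]
    rw [Finset.sum_comm]
    refine Finset.sum_congr rfl fun k _ => Finset.sum_congr rfl fun l _ => ?_
    by_cases hlk : lam l = lam k
    · have : c k = c l := by simp [hc, hlk]
      have h3 : √(c l) * √(c l) = c l := Real.mul_self_sqrt (le_max_right _ _)
      rw [this]
      linear_combination -(β l * β k * b (p l) (p k)) * h3
    · rw [horth l k hlk]; ring
  have := hb (∑ l, (√(c l) * β l) • p l)
  linarith

/-- Spectral truncation: up to an element of the span of the first `m` eigenvectors, the form `b` is
controlled by `a` with constant `(lam m)⁻¹`. The part `k` in the kernel of `b` carries the infinite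
eigenvalues; it is `a`-orthogonal to all `p l`. -/
theorem exists_mem_span_mul_apply_sub_le {V : Type*} [AddCommGroup V] [Module ℝ V]
    (a b : LinearMap.BilinForm ℝ V) (has : ∀ x y, a x y = a y x) (ha : ∀ x, 0 ≤ a x x)
    (hs : ∀ x y, b x y = b y x) (hb : ∀ x, 0 ≤ b x x) {n : ℕ} (p : Fin n → V) (lam : Fin n → ℝ)
    (hmono : Monotone lam) (hp : ∀ l v, a (p l) v = lam l * b (p l) v) (m : Fin n)
    (α : Fin n → ℝ) (x : V) (hx : ∀ v, b (x - ∑ l, α l • p l) v = 0) :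
    ∃ z ∈ Submodule.span ℝ (p '' {l | l < m}), lam m * b (x - z) (x - z) ≤ a x x := by
  set y := ∑ l, α l • p l
  set k := x - y
  have hyspan : y ∈ Submodule.span ℝ (range p) :=
    Submodule.sum_mem _ fun l _ => Submodule.smul_mem _ _ (Submodule.subset_span ⟨l, rfl⟩)
  obtain ⟨z, hz, hzw⟩ := exists_mem_span_forall_apply_sub_eq_zero b hs hb
    ((toFinite {l | l < m}).image p) y
  obtain ⟨β, hβ⟩ := (Submodule.mem_span_range_iff_exists_fun ℝ).1
    (sub_mem hyspan (Submodule.span_mono (image_subset_range _ _) hz))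
  have hkey := mul_apply_self_le_of_orthogonal a b has hs hb p lam hmono hp m β fun l hl => by
    rw [hβ]; exact hzw _ (Submodule.subset_span ⟨l, hl, rfl⟩)
  rw [hβ] at hkey
  have hpk : ∀ l, b (p l) k = 0 := fun l => by rw [hs]; exact hx _
  have hak : ∀ w ∈ Submodule.span ℝ (range p), a w k = 0 := by
    intro w hw
    have : Submodule.span ℝ (range p) ≤ LinearMap.ker (a.flip k) := by
      rw [Submodule.span_le]
      rintro _ ⟨l, rfl⟩
      simp [hp, hpk]
    exact this hw
  have haz : a z (y - z) = 0 := by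
    have : Submodule.span ℝ (p '' {l | l < m}) ≤ LinearMap.ker (a.flip (y - z)) := by
      rw [Submodule.span_le]
      rintro _ ⟨l, hl, rfl⟩
      have := hzw (p l) (Submodule.subset_span ⟨l, hl, rfl⟩)
      change a (p l) (y - z) = 0
      rw [hp, this, mul_zero]
    exact this hz
  have hzspan := Submodule.span_mono (R := ℝ) (image_subset_range _ _) hz
  have hzk := hak z hzspan
  refine ⟨z, hz, ?_⟩
  have e1 : x - z = (y - z) + k := by simp [k]
  have e2 : x = z + (y - z) + k := by simp [k]
  have e3 : b (x - z) (x - z) = b (y - z) (y - z) := by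
    rw [e1]
    simp only [map_add, LinearMap.add_apply, hx, hs (y - z) k]
    ring
  have e4 : a x x = a z z + a (y - z) (y - z) + a k k := by
    have h1 : a (y - z) k = 0 := hak _ (sub_mem hyspan hzspan)
    conv_lhs => rw [e2]
    simp only [map_add, LinearMap.add_apply, haz, hzk, h1, has (y - z) z, has k z,
      has k (y - z)]
    ring
  rw [e3, e4]
  linarith [ha z, ha k]

/-! ### Elements and subdomains -/

section Mesh

variable {d : ℕ} {Ω : Set (E d)}

theorem Triangulation.volume_frontier (t : Finset (E d)) :
    volume (frontier (convexHull ℝ (t : Set (E d)))) = 0 :=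
  (convex_convexHull ℝ _).addHaar_frontier volume

/-- Almost every point of `Ω` lies in the interior of an element. -/
theorem Triangulation.ae_mem_interior (T : Triangulation Ω) :
    ∀ᵐ x ∂(volume.restrict Ω), ∃ t ∈ T.elems, x ∈ interior (convexHull ℝ (t : Set (E d))) := by
  have h0 : ∀ᵐ x ∂(volume.restrict Ω), ∀ t ∈ T.elems,
      x ∉ frontier (convexHull ℝ (t : Set (E d))) := by
    refine (ae_ball_iff T.elems.countable_toSet).2 fun t _ => ?_
    exact ae_restrict_of_ae (measure_eq_zero_iff_ae_notMem.1 (volume_frontier t))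
  filter_upwards [h0, ae_restrict_mem T.isOpen.measurableSet] with x hx hxΩ
  have h1 := subset_closure hxΩ
  rw [← T.cover] at h1
  obtain ⟨t, ht, hxt⟩ := mem_iUnion₂.1 h1
  refine ⟨t, ht, ?_⟩
  by_contra hni
  exact hx t ht ⟨subset_closure hxt, hni⟩

/-- Two different elements meet in a null set, namely in the simplex spanned by their common
vertices. -/
theorem Triangulation.volume_inter (T : Triangulation Ω) {s t : Finset (E d)} (hs : s ∈ T.elems)
    (ht : t ∈ T.elems) (hst : s ≠ t) :
    volume (convexHull ℝ (s : Set (E d)) ∩ convexHull ℝ (t : Set (E d))) = 0 := by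
  classical
  rw [T.inter s hs t ht, ← Finset.coe_inter]
  refine measure_mono_null ?_ (volume_frontier (s ∩ t))
  have hint : interior (convexHull ℝ ((s ∩ t : Finset (E d)) : Set (E d))) = ∅ := by
    by_contra hne
    have h1 := interior_convexHull_nonempty_iff_affineSpan_eq_top.1 (nonempty_iff_ne_empty.2 hne)
    have hind : AffineIndependent ℝ
        ((↑) : ((s ∩ t : Finset (E d)) : Set (E d)) → E d) :=
      AffineIndependent.mono (t := (s : Set (E d))) (T.indep s hs)
        (by exact_mod_cast Finset.inter_subset_left)
    have h2 := hind.affineSpan_eq_top_iff_card_eq_finrank_add_one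
    rw [Subtype.range_coe_subtype] at h2
    have h3 := h2.1 h1
    simp only [Finset.coe_sort_coe, Fintype.card_coe, finrank_euclideanSpace, Fintype.card_fin]
      at h3
    have h4 : s ∩ t = s :=
      Finset.eq_of_subset_of_card_le Finset.inter_subset_left (by rw [h3, T.card_eq s hs])
    have h5 : s ∩ t = t :=
      Finset.eq_of_subset_of_card_le Finset.inter_subset_right (by rw [h3, T.card_eq t ht])
    exact hst (h4.symm.trans h5)
  intro x hx
  exact ⟨subset_closure hx, by rw [hint]; simp⟩

end Mesh

namespace Decomposition

variable {d N : ℕ} {Ω : Set (E d)} {T : Triangulation Ω} {ι : Type*} {F : FESpace T ι}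

theorem isOpen_sub (D : Decomposition F N) (j : Fin N) : IsOpen (D.sub j) :=
  T.isOpen.inter isOpen_interior

theorem sub_subset (D : Decomposition F N) (j : Fin N) : D.sub j ⊆ Ω := inter_subset_left

/-- The interior of an element outside `Ω_j` does not meet `Ω_j`: the intersection is open and is
covered by finitely many null sets. -/
theorem disjoint_interior_sub (D : Decomposition F N) (j : Fin N) {t : Finset (E d)}
    (ht : t ∈ T.elems) (htj : t ∉ D.ext j) :
    Disjoint (interior (convexHull ℝ (t : Set (E d)))) (D.sub j) := by
  rw [disjoint_iff_inter_eq_empty]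
  refine ((isOpen_interior.inter (D.isOpen_sub j)).measure_eq_zero_iff volume).1 ?_
  have hsub : interior (convexHull ℝ (t : Set (E d))) ∩ D.sub j ⊆
      ⋃ s ∈ D.ext j, convexHull ℝ (s : Set (E d)) ∩ convexHull ℝ (t : Set (E d)) := by
    rintro x ⟨hxt, -, hx⟩
    obtain ⟨s, hs, hxs⟩ := mem_iUnion₂.1 (interior_subset hx)
    exact mem_iUnion₂.2 ⟨s, hs, hxs, interior_subset hxt⟩
  refine measure_mono_null hsub ((measure_biUnion_null_iff (D.ext j).countable_toSet).2 ?_)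
  intro s hs
  exact T.volume_inter (D.ext_subset j hs) ht (by rintro rfl; exact htj hs)

theorem mem_sub_iff (D : Decomposition F N) (j : Fin N) {t : Finset (E d)}
    (ht : t ∈ T.elems) {x : E d} (hx : x ∈ interior (convexHull ℝ (t : Set (E d)))) :
    x ∈ D.sub j ↔ t ∈ D.ext j := by
  refine ⟨fun h => ?_, fun h => D.interior_subset_sub j h hx⟩
  by_contra htj
  exact disjoint_left.1 (D.disjoint_interior_sub j ht htj) hx h

open scoped Classical in
theorem card_filter_mem_sub_le (D : Decomposition F N) {t : Finset (E d)} (ht : t ∈ T.elems)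
    {x : E d} (hx : x ∈ interior (convexHull ℝ (t : Set (E d)))) :
    (Finset.univ.filter (fun j => x ∈ D.sub j)).card ≤ D.k0 := by
  simp only [D.mem_sub_iff _ ht hx]
  unfold k0
  convert Finset.le_sup (f := fun t => (Finset.univ.filter (fun j => t ∈ D.ext j)).card) ht

end Decomposition

/-! ### The partition of unity -/

namespace FESpace

variable {d : ℕ} {Ω : Set (E d)} {T : Triangulation Ω} {ι : Type*}

theorem HasDofs.unique {F : FESpace T ι} {c : ι → ℝ} {v w : E d → ℝ} (hv : F.HasDofs c v)
    (hw : F.HasDofs c w) : v = w := by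
  funext x
  by_cases hx : x ∈ Ω
  · have h1 := subset_closure hx
    rw [← T.cover] at h1
    obtain ⟨t, ht, hxt⟩ := mem_iUnion₂.1 h1
    exact (hv.2.2 ⟨t, ht⟩ ⟨x, hxt⟩).trans (hw.2.2 ⟨t, ht⟩ ⟨x, hxt⟩).symm
  · rw [hv.2.1 x hx, hw.2.1 x hx]

theorem HasDofs.sub {F : FESpace T ι} {c c' : ι → ℝ} {v v' : E d → ℝ}
    (h : F.HasDofs c v) (h' : F.HasDofs c' v') : F.HasDofs (c - c') (v - v') := by
  simpa [sub_eq_add_neg] using h.add (h'.smul (-1))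

theorem HasDofs.eq_of_eqOn_interior {F : FESpace T ι} {c c' : ι → ℝ} {v v' : E d → ℝ}
    (h : F.HasDofs c v) (h' : F.HasDofs c' v') {t : Finset (E d)} (ht : t ∈ T.elems)
    (heq : ∀ x ∈ interior (convexHull ℝ (t : Set (E d))), v x = v' x) {i : ι}
    (hi : F.site i ⊆ t) : c i = c' i := by
  have := (h.sub h').eq_zero_of_interior ht (fun x hx => by simp [heq x hx]) hi
  exact sub_eq_zero.1 this

theorem HasDofs.memH10 {F : FESpace T ι} {c : ι → ℝ} {v : E d → ℝ} (h : F.HasDofs c v) :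
    MemH10 Ω v := by
  obtain ⟨w, h1, h2, h3⟩ := F.conforming c h.1
  rwa [h.unique ⟨h.1, h1, h3⟩]

theorem basisFun_eq_zero (F : FESpace T ι) (i : F.free) {t : Finset (E d)} (ht : t ∈ T.elems)
    (hit : ¬ F.site i ⊆ t) {x : E d} (hx : x ∈ convexHull ℝ (t : Set (E d))) :
    F.basisFun i x = 0 := by
  classical
  have h := (F.basisFun_hasDofs i).2.2 ⟨t, ht⟩ ⟨x, hx⟩
  have h0 : (fun k : {k : ι // F.site k ⊆ t} =>
      (Pi.single (i : ι) (1 : ℝ) : ι → ℝ) k) = 0 := by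
    funext k
    refine Pi.single_eq_of_ne (fun hk => hit ?_) _
    rw [← hk]; exact k.2
  rw [h]
  refine (congrArg (fun c => ((F.nodal ⟨t, ht⟩).symm c).1 ⟨x, hx⟩) h0).trans ?_
  simp

theorem HasDofs.eq_sum_basisFun {F : FESpace T ι} {c : ι → ℝ} {v : E d → ℝ}
    (h : F.HasDofs c v) : v = ∑ i : F.free, c i • F.basisFun i := by
  classical
  refine h.unique ?_
  convert HasDofs.sum (F := F) Finset.univ
    (fun i : F.free => c i • (Pi.single (i : ι) (1 : ℝ) : ι → ℝ)) (fun i => c i • F.basisFun i)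
    (fun i _ => (F.basisFun_hasDofs i).smul _) using 1
  funext k
  rw [Finset.sum_apply]
  by_cases hk : k ∈ F.free
  · rw [Finset.sum_eq_single (⟨k, hk⟩ : F.free)]
    · simp
    · rintro b - hb
      have : k ≠ b := fun h => hb (Subtype.ext h.symm)
      simp [this]
    · simp
  · rw [h.1 k hk]
    refine (Finset.sum_eq_zero fun b _ => ?_).symm
    have : k ≠ b := by rintro rfl; exact hk b.2
    simp [this]

end FESpace

namespace Decomposition

variable {d N : ℕ} {Ω : Set (E d)} {T : Triangulation Ω} {ι : Type*} {F : FESpace T ι}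

/-- A basis function of an internal degree of freedom is supported in the subdomain. -/
theorem localFun_eq_basisFun (D : Decomposition F N) (j : Fin N) (i : D.dofs j)
    (hi : (i : F.free) ∈ D.intDofs j) : (D.localFun j i : E d → ℝ) = F.basisFun i := by
  classical
  obtain ⟨c, hc⟩ := (D.localFun_mem_V j i hi).2
  have hb := F.basisFun_hasDofs i
  suffices c = Pi.single ((i : F.free) : ι) (1 : ℝ) by rw [this] at hc; exact hc.unique hb
  funext k
  obtain ⟨t, ht, hkt⟩ := F.site_subset k
  refine hc.eq_of_eqOn_interior hb ht (fun x hx => ?_) hkt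
  by_cases htj : t ∈ D.ext j
  · exact indicator_of_mem (D.interior_subset_sub j htj hx) _
  · rw [F.basisFun_eq_zero i ht (fun h => htj (hi t ht h)) (interior_subset hx)]
    exact indicator_of_notMem (fun h => htj ((D.mem_sub_iff j ht hx).1 h)) _

/-- The restriction of `v ∈ V^h` to `Ω_j`, as an element of `Ṽ_j`. -/
noncomputable def restr (D : Decomposition F N) (j : Fin N) (v : E d → ℝ) (hv : v ∈ F.space) :
    D.Vt j :=
  ⟨restrictTo (D.sub j) v, Submodule.mem_map_of_mem hv⟩

theorem nodalBasis_repr_restr [Fintype ι] (D : Decomposition F N) (j : Fin N) {c : ι → ℝ}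
    {v : E d → ℝ} (h : F.HasDofs c v) (i : D.dofs j) :
    (D.nodalBasis j).repr (D.restr j v ⟨c, h⟩) i = c (i : F.free) := by
  classical
  have hw : ∀ x ∈ D.sub j, (D.restr j v ⟨c, h⟩ : E d → ℝ) x = v x :=
    fun x hx => indicator_of_mem hx v
  generalize D.restr j v ⟨c, h⟩ = w at hw ⊢
  have hS := hasDofs_combo (F := F) (S := D.dofs j) (fun i => (D.nodalBasis j).repr w i)
  obtain ⟨t, ht, hit⟩ := i.2
  have := hS.eq_of_eqOn_interior h (D.ext_subset j ht) (fun x hx => ?_) hit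
  · rw [dif_pos ⟨i.1.2, i.2⟩] at this
    exact this
  · have hxs := D.interior_subset_sub j ht hx
    have h1 := congrArg (fun w : D.Vt j => (w : E d → ℝ) x) ((D.nodalBasis j).sum_repr w)
    rw [← hw x hxs, ← h1]
    simp [nodalBasis, localFun, restrictTo, indicator_of_mem hxs]

open scoped Classical in
theorem coe_Xi_restr [Fintype ι] (D : Decomposition F N) (j : Fin N) {c : ι → ℝ}
    {v : E d → ℝ} (h : F.HasDofs c v) :
    (D.Xi j (D.restr j v ⟨c, h⟩) : E d → ℝ)
      = ∑ i : F.free, if i ∈ D.intDofs j then (1 / (D.mu i : ℝ) * c i) • F.basisFun i else 0 := by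
  have h1 : (D.Xi j (D.restr j v ⟨c, h⟩) : E d → ℝ) = ∑ i : D.dofs j,
      if (i : F.free) ∈ D.intDofs j then
        (1 / (D.mu i : ℝ) * c (i : F.free)) • F.basisFun i else 0 := by
    rw [Xi, LinearMap.sum_apply, Submodule.coe_sum]
    refine Finset.sum_congr rfl fun i _ => ?_
    split_ifs with hi
    · simp [D.nodalBasis_repr_restr j h i, D.localFun_eq_basisFun j i hi]
    · simp
  rw [h1, ← Finset.sum_subtype (Finset.univ.filter (· ∈ D.dofs j)) (by simp)
    (fun i : F.free => if i ∈ D.intDofs j then (1 / (D.mu i : ℝ) * c i) • F.basisFun i else 0),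
    Finset.sum_filter]
  refine Finset.sum_congr rfl fun i _ => ?_
  by_cases hi : i ∈ D.dofs j
  · rw [if_pos hi]
  · rw [if_neg hi, if_neg fun h' => hi (D.intDofs_subset j h')]

/-- The overlap contains a layer of elements, so each degree of freedom is internal to the
subdomain that has an element carrying it in its core. -/
theorem mu_pos (D : Decomposition F N) (i : F.free) : 0 < D.mu i := by
  classical
  obtain ⟨t, ht, hit⟩ := F.site_subset i
  obtain ⟨j, hj⟩ := (D.core_cover t).1 ht
  have hij : i ∈ D.intDofs j := fun s hs his =>
    D.layer_subset j (Finset.mem_filter.2 ⟨hs, i, i.2, his, t, hj, hit⟩)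
  have : Nonempty {j : Fin N // i ∈ D.intDofs j} := ⟨⟨j, hij⟩⟩
  exact Nat.card_pos

/-- The operators `Ξ_j` form a partition of unity. -/
theorem sum_Xi_restr [Fintype ι] (D : Decomposition F N) {v : E d → ℝ} (hv : v ∈ F.space) :
    ∑ j, (D.Xi j (D.restr j v hv) : E d → ℝ) = v := by
  classical
  obtain ⟨c, h⟩ := hv
  simp only [D.coe_Xi_restr _ h]
  rw [Finset.sum_comm]
  conv_rhs => rw [h.eq_sum_basisFun]
  refine Finset.sum_congr rfl fun i _ => ?_
  have hmu : (D.mu i : ℝ) ≠ 0 := by exact_mod_cast (D.mu_pos i).ne'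
  have hcard : (Finset.univ.filter (fun j => i ∈ D.intDofs j)).card = D.mu i := by
    rw [mu, Nat.card_eq_fintype_card, Fintype.card_subtype]
  rw [← Finset.sum_filter, Finset.sum_const, hcard, ← Nat.cast_smul_eq_nsmul ℝ, smul_smul]
  congr 1
  field_simp

end Decomposition

/-! ### Weak gradients -/

section WeakGradient

variable {d : ℕ} {D D' : Set (E d)} {u v : E d → ℝ} {g h : E d → E d}

theorem memLp_apply {μ : Measure (E d)} (hg : MemLp g 2 μ) (i : Fin d) :
    MemLp (fun x => g x i) 2 μ :=
  (EuclideanSpace.proj i : E d →L[ℝ] ℝ).comp_memLp' hg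

theorem IsTestFunction.memLp {φ : E d → ℝ} (hφ : IsTestFunction D φ) (μ : Measure (E d))
    [IsFiniteMeasureOnCompacts μ] : MemLp φ 2 μ :=
  hφ.1.continuous.memLp_of_hasCompactSupport hφ.2.1

theorem IsTestFunction.memLp_fderiv {φ : E d → ℝ} (hφ : IsTestFunction D φ) (e : E d)
    (μ : Measure (E d)) [IsFiniteMeasureOnCompacts μ] : MemLp (fun x => fderiv ℝ φ x e) 2 μ :=
  ((hφ.1.continuous_fderiv (by simp)).clm_apply
    continuous_const).memLp_of_hasCompactSupport (hφ.2.1.fderiv_apply ℝ e)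

theorem IsWeakGradient.add (hu : MemLp u 2 (volume.restrict D))
    (hv : MemLp v 2 (volume.restrict D)) (hg : IsWeakGradient D u g)
    (hh : IsWeakGradient D v h) : IsWeakGradient D (u + v) (g + h) := by
  refine ⟨hg.1.add hh.1, fun φ hφ i => ?_⟩
  have hd := hφ.memLp_fderiv (EuclideanSpace.single i 1) (volume.restrict D)
  have hm := hφ.memLp (volume.restrict D)
  simp only [Pi.add_apply, PiLp.add_apply, add_mul]
  have e1 := integral_add (hu.integrable_mul hd) (hv.integrable_mul hd)
  have e2 := integral_add ((memLp_apply hg.1 i).integrable_mul hm)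
    ((memLp_apply hh.1 i).integrable_mul hm)
  simp only [Pi.mul_apply] at e1 e2
  rw [e1, e2, hg.2 φ hφ i, hh.2 φ hφ i]
  ring

theorem IsWeakGradient.smul (r : ℝ) (hg : IsWeakGradient D u g) :
    IsWeakGradient D (r • u) (r • g) := by
  refine ⟨hg.1.const_smul r, fun φ hφ i => ?_⟩
  simp only [Pi.smul_apply, PiLp.smul_apply, smul_eq_mul, mul_assoc]
  rw [integral_const_mul, integral_const_mul, hg.2 φ hφ i]
  ring

theorem isWeakGradient_zero (D : Set (E d)) : IsWeakGradient D 0 0 :=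
  ⟨MemLp.zero, fun φ _ i => by simp⟩

theorem IsWeakGradient.mono_congr (hg : IsWeakGradient D u g) (hD : MeasurableSet D)
    (hD' : MeasurableSet D') (hsub : D' ⊆ D) (huv : EqOn v u D') : IsWeakGradient D' v g := by
  refine ⟨hg.1.mono_measure (Measure.restrict_mono_set _ hsub), fun φ hφ i => ?_⟩
  have h0 : ∀ x ∈ D \ D', φ x = 0 ∧ fderiv ℝ φ x = 0 := by
    intro x hx
    have hx' : x ∉ tsupport φ := fun h => hx.2 (hφ.2.2 h)
    refine ⟨image_eq_zero_of_notMem_tsupport hx', ?_⟩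
    by_contra hne
    exact hx' (support_fderiv_subset ℝ hne)
  rw [setIntegral_congr_fun (g := fun x => u x * fderiv ℝ φ x (EuclideanSpace.single i 1)) hD'
      (fun x hx => by simp only [huv hx]),
    ← setIntegral_eq_of_subset_of_forall_sdiff_eq_zero hD hsub
      (fun x hx => by simp [(h0 x hx).2]),
    ← setIntegral_eq_of_subset_of_forall_sdiff_eq_zero hD hsub
      (fun x hx => by simp [(h0 x hx).1])]
  exact hg.2 φ ⟨hφ.1, hφ.2.1, hφ.2.2.trans hsub⟩ i

theorem IsWeakGradient.ae_eq (hD : IsOpen D) (hg : IsWeakGradient D u g)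
    (hh : IsWeakGradient D u h) : g =ᵐ[volume.restrict D] h := by
  have hi : ∀ i : Fin d, ∀ᵐ x ∂(volume.restrict D), g x i - h x i = 0 := by
    intro i
    rw [ae_restrict_iff' hD.measurableSet]
    have hgi := memLp_apply hg.1 i
    have hhi := memLp_apply hh.1 i
    refine hD.ae_eq_zero_of_integral_contDiff_smul_eq_zero (f := fun x => g x i - h x i) ?_ ?_
    · rw [locallyIntegrableOn_iff hD.isLocallyClosed]
      intro k hk hkc
      have : IsFiniteMeasure (volume.restrict k) := ⟨by simpa using hkc.measure_lt_top⟩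
      exact ((hgi.sub hhi).mono_measure (Measure.restrict_mono_set _ hk)).integrable one_le_two
    · intro φ h1 h2 h3
      have hm := (IsTestFunction.memLp ⟨h1, h2, h3⟩ (volume.restrict D) : MemLp φ 2 _)
      have e : ∫ x, φ x • (g x i - h x i) = ∫ x in D, φ x • (g x i - h x i) :=
        (setIntegral_eq_integral_of_forall_compl_eq_zero fun x hx => by
          simp [image_eq_zero_of_notMem_tsupport fun hx' => hx (h3 hx')]).symm
      have e1 := hg.2 φ ⟨h1, h2, h3⟩ i
      have e2 := hh.2 φ ⟨h1, h2, h3⟩ i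
      have e3 := integral_sub (hgi.integrable_mul hm) (hhi.integrable_mul hm)
      simp only [Pi.mul_apply, ← sub_mul] at e3
      rw [e]
      simp only [smul_eq_mul, mul_comm (φ _)]
      linarith
  filter_upwards [ae_all_iff.2 hi] with x hx
  ext i
  exact sub_eq_zero.1 (hx i)

theorem MemH1.isWeakGradient (hu : MemH1 D u) : IsWeakGradient D u (weakGrad D u) := by
  unfold weakGrad
  rw [dif_pos hu.2]
  exact hu.2.choose_spec

theorem MemH1.mono_congr (hu : MemH1 D u) (hD : MeasurableSet D) (hD' : MeasurableSet D')
    (hsub : D' ⊆ D) (huv : EqOn v u D') : MemH1 D' v :=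
  ⟨(memLp_congr_ae (ae_restrict_of_forall_mem hD' huv)).2
      (hu.1.mono_measure (Measure.restrict_mono_set _ hsub)),
    _, hu.isWeakGradient.mono_congr hD hD' hsub huv⟩

/-- The space `H¹(D)`. -/
def H1 (D : Set (E d)) : Submodule ℝ (E d → ℝ) where
  carrier := {u | MemH1 D u}
  add_mem' hu hv := ⟨hu.1.add hv.1, _, hu.isWeakGradient.add hu.1 hv.1 hv.isWeakGradient⟩
  zero_mem' := ⟨MemLp.zero, 0, isWeakGradient_zero D⟩
  smul_mem' r _ hu := ⟨hu.1.const_smul r, _, hu.isWeakGradient.smul r⟩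

/-- The pair `(∇u, u)` of which the energy density is a quadratic form. -/
noncomputable def jet (D : Set (E d)) (u : E d → ℝ) (x : E d) : E d × ℝ := (weakGrad D u x, u x)

theorem jet_add (hD : IsOpen D) (hu : u ∈ H1 D) (hv : v ∈ H1 D) :
    jet D (u + v) =ᵐ[volume.restrict D] jet D u + jet D v := by
  filter_upwards [((H1 D).add_mem hu hv).isWeakGradient.ae_eq hD
    (hu.isWeakGradient.add hu.1 hv.1 hv.isWeakGradient)] with x hx
  simp [jet, hx]

theorem jet_smul (hD : IsOpen D) (r : ℝ) (hu : u ∈ H1 D) :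
    jet D (r • u) =ᵐ[volume.restrict D] r • jet D u := by
  filter_upwards [((H1 D).smul_mem r hu).isWeakGradient.ae_eq hD
    (hu.isWeakGradient.smul r)] with x hx
  simp [jet, hx]

theorem jet_sum (hD : IsOpen D) {κ : Type*} (s : Finset κ) (u : κ → E d → ℝ)
    (hu : ∀ k, u k ∈ H1 D) :
    jet D (∑ k ∈ s, u k) =ᵐ[volume.restrict D] ∑ k ∈ s, jet D (u k) := by
  classical
  induction s using Finset.induction_on with
  | empty =>
    have := jet_smul hD 0 (H1 D).zero_mem
    simpa using this
  | insert a s ha ih =>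
    rw [Finset.sum_insert ha, Finset.sum_insert ha]
    exact (jet_add hD (hu a) ((H1 D).sum_mem fun k _ => hu k)).trans
      (Filter.EventuallyEq.rfl.add ih)

theorem jet_mono_congr (hD : IsOpen D) (hD' : IsOpen D') (hsub : D' ⊆ D) (hu : u ∈ H1 D)
    (huv : EqOn v u D') : jet D' v =ᵐ[volume.restrict D'] jet D u := by
  have hv : MemH1 D' v := MemH1.mono_congr hu hD.measurableSet hD'.measurableSet hsub huv
  filter_upwards [hv.isWeakGradient.ae_eq hD'
    (hu.isWeakGradient.mono_congr hD.measurableSet hD'.measurableSet hsub huv),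
    ae_restrict_mem hD'.measurableSet] with x hx hxD
  simp [jet, hx, huv hxD]

end WeakGradient

/-! ### The energy form as a bilinear form -/

section Energy

variable {d : ℕ} {D D' : Set (E d)} {u v : E d → ℝ}

/-- The energy density at a point, as a bilinear form in `(∇u, u)` and `(∇v, v)`. -/
def pointForm (M : Matrix (Fin d) (Fin d) ℝ) (c : ℝ) : LinearMap.BilinForm ℝ (E d × ℝ) :=
  LinearMap.mk₂ ℝ (fun X Y => M.mulVec X.1.ofLp ⬝ᵥ Y.1.ofLp + c * X.2 * Y.2)
    (fun X X' Y => by simp [Matrix.mulVec_add, add_dotProduct]; ring)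
    (fun r X Y => by simp [Matrix.mulVec_smul]; ring)
    (fun X Y Y' => by simp [dotProduct_add]; ring)
    (fun r X Y => by simp; ring)

theorem pointForm_apply (M : Matrix (Fin d) (Fin d) ℝ) (c : ℝ) (X Y : E d × ℝ) :
    pointForm M c X Y = M.mulVec X.1.ofLp ⬝ᵥ Y.1.ofLp + c * X.2 * Y.2 := rfl

theorem energyForm_eq_integral_jet (A : E d → Matrix (Fin d) (Fin d) ℝ) (cp : E d → ℝ)
    (D : Set (E d)) (u v : E d → ℝ) : energyForm A cp D u v
      = ∫ x in D, pointForm (A x) (cp x) (jet D u x) (jet D v x) := rfl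

/-- The conditions on the coefficients of the energy form on `D`: `A` is symmetric
with `0 ≤ A ξ · ξ ≤ amax |ξ|²`, and `cp` is bounded and nonnegative. -/
structure Coefficients (A : E d → Matrix (Fin d) (Fin d) ℝ) (cp : E d → ℝ) (amax : ℝ)
    (D : Set (E d)) : Prop where
  meas : ∀ i k, AEStronglyMeasurable (fun x => A x i k) (volume.restrict D)
  symm : ∀ x ∈ D, (A x).IsSymm
  nonneg : ∀ x ∈ D, ∀ ξ : E d, 0 ≤ (A x).mulVec ξ.ofLp ⬝ᵥ ξ.ofLp
  le : ∀ x ∈ D, ∀ ξ : E d, (A x).mulVec ξ.ofLp ⬝ᵥ ξ.ofLp ≤ amax * ‖ξ‖ ^ 2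
  cp_memLp : MemLp cp ⊤ (volume.restrict D)
  cp_nonneg : ∀ x ∈ D, 0 ≤ cp x

namespace Coefficients

variable {A : E d → Matrix (Fin d) (Fin d) ℝ} {cp : E d → ℝ} {amax : ℝ}

theorem mono (hc : Coefficients A cp amax D) (h : D' ⊆ D) : Coefficients A cp amax D' where
  meas i k := (hc.meas i k).mono_measure (Measure.restrict_mono_set _ h)
  symm x hx := hc.symm x (h hx)
  nonneg x hx := hc.nonneg x (h hx)
  le x hx := hc.le x (h hx)
  cp_memLp := hc.cp_memLp.mono_measure (Measure.restrict_mono_set _ h)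
  cp_nonneg x hx := hc.cp_nonneg x (h hx)

theorem pointForm_symm (hc : Coefficients A cp amax D) {x : E d} (hx : x ∈ D) (X Y : E d × ℝ) :
    pointForm (A x) (cp x) X Y = pointForm (A x) (cp x) Y X := by
  have : (A x).mulVec X.1.ofLp ⬝ᵥ Y.1.ofLp = (A x).mulVec Y.1.ofLp ⬝ᵥ X.1.ofLp := by
    rw [dotProduct_comm, Matrix.dotProduct_mulVec, ← Matrix.mulVec_transpose, hc.symm x hx]
  rw [pointForm_apply, pointForm_apply, this]
  ring

theorem pointForm_nonneg (hc : Coefficients A cp amax D) {x : E d} (hx : x ∈ D) (X : E d × ℝ) :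
    0 ≤ pointForm (A x) (cp x) X X := by
  have h2 : 0 ≤ cp x * (X.2 * X.2) := mul_nonneg (hc.cp_nonneg x hx) (mul_self_nonneg _)
  have := hc.nonneg x hx X.1
  rw [pointForm_apply]
  linarith

/-- Young's inequality for the semidefinite form `A x`. -/
theorem abs_mulVec_dotProduct_le (hc : Coefficients A cp amax D) {x : E d} (hx : x ∈ D)
    (ξ η : E d) : |(A x).mulVec ξ.ofLp ⬝ᵥ η.ofLp| ≤ amax / 2 * (‖ξ‖ ^ 2 + ‖η‖ ^ 2) := by
  have hs : (A x).mulVec η.ofLp ⬝ᵥ ξ.ofLp = (A x).mulVec ξ.ofLp ⬝ᵥ η.ofLp := by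
    simpa [pointForm_apply] using hc.pointForm_symm hx (η, 0) (ξ, 0)
  have h1 := hc.nonneg x hx (ξ + η)
  have h2 := hc.nonneg x hx (ξ - η)
  have h3 := hc.le x hx ξ
  have h4 := hc.le x hx η
  simp only [WithLp.ofLp_add, WithLp.ofLp_sub, Matrix.mulVec_add, Matrix.mulVec_sub,
    add_dotProduct, sub_dotProduct, dotProduct_add, dotProduct_sub, hs] at h1 h2
  rw [abs_le]
  constructor <;> linarith

theorem integrable_pointForm (hc : Coefficients A cp amax D) (hD : IsOpen D) (hu : u ∈ H1 D)
    (hv : v ∈ H1 D) :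
    IntegrableOn (fun x => pointForm (A x) (cp x) (jet D u x) (jet D v x)) D := by
  have hg := hu.isWeakGradient.1
  have hh := hv.isWeakGradient.1
  refine Integrable.add ?_ ?_
  · refine Integrable.mono' (((hg.integrable_norm_pow two_ne_zero).add
      (hh.integrable_norm_pow two_ne_zero)).const_mul (amax / 2)) ?_ ?_
    · refine Finset.aestronglyMeasurable_fun_sum _ fun i _ => ?_
      refine AEStronglyMeasurable.mul ?_ (memLp_apply hh i).1
      exact Finset.aestronglyMeasurable_fun_sum Finset.univ
        (f := fun k x => A x i k * weakGrad D u x k) fun k _ =>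
        (hc.meas i k).mul (memLp_apply hg k).1
    · filter_upwards [ae_restrict_mem hD.measurableSet] with x hx
      exact hc.abs_mulVec_dotProduct_le hx _ _
  · exact (MemLp.mul (r := 2) hu.1 hc.cp_memLp).integrable_mul hv.1

theorem energyForm_symm (hc : Coefficients A cp amax D) (hD : IsOpen D) (u v : E d → ℝ) :
    energyForm A cp D u v = energyForm A cp D v u := by
  simp only [energyForm_eq_integral_jet]
  exact setIntegral_congr_fun hD.measurableSet fun x hx => hc.pointForm_symm hx _ _

theorem energyForm_nonneg (hc : Coefficients A cp amax D) (hD : IsOpen D) (u : E d → ℝ) :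
    0 ≤ energyForm A cp D u u := by
  rw [energyForm_eq_integral_jet]
  exact setIntegral_nonneg hD.measurableSet fun x hx => hc.pointForm_nonneg hx _

theorem energyForm_add_left (hc : Coefficients A cp amax D) (hD : IsOpen D) {w : E d → ℝ}
    (hu : u ∈ H1 D) (hv : v ∈ H1 D) (hw : w ∈ H1 D) :
    energyForm A cp D (u + v) w = energyForm A cp D u w + energyForm A cp D v w := by
  simp only [energyForm_eq_integral_jet]
  rw [← integral_add (hc.integrable_pointForm hD hu hw) (hc.integrable_pointForm hD hv hw)]
  refine integral_congr_ae ?_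
  filter_upwards [jet_add hD hu hv] with x hx
  rw [hx, Pi.add_apply, map_add, LinearMap.add_apply]

theorem energyForm_smul_left (A : E d → Matrix (Fin d) (Fin d) ℝ) (cp : E d → ℝ)
    (hD : IsOpen D) (r : ℝ) (hu : u ∈ H1 D) (w : E d → ℝ) :
    energyForm A cp D (r • u) w = r * energyForm A cp D u w := by
  simp only [energyForm_eq_integral_jet]
  rw [← integral_const_mul]
  refine integral_congr_ae ?_
  filter_upwards [jet_smul hD r hu] with x hx
  rw [hx, Pi.smul_apply, map_smul, LinearMap.smul_apply, smul_eq_mul]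

/-- The energy form on `H¹(D)`. -/
noncomputable def energyBilin (hc : Coefficients A cp amax D) (hD : IsOpen D) :
    LinearMap.BilinForm ℝ (H1 D) :=
  LinearMap.mk₂ ℝ (fun u v => energyForm A cp D u v)
    (fun u v w => hc.energyForm_add_left hD u.2 v.2 w.2)
    (fun r u w => energyForm_smul_left A cp hD r u.2 w)
    (fun u v w => by
      rw [hc.energyForm_symm hD, hc.energyForm_symm hD u, hc.energyForm_symm hD u]
      exact hc.energyForm_add_left hD v.2 w.2 u.2)
    (fun r u v => by
      rw [hc.energyForm_symm hD, hc.energyForm_symm hD u]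
      exact energyForm_smul_left A cp hD r v.2 u)

theorem energyNorm_sq (hc : Coefficients A cp amax D) (hD : IsOpen D) (u : E d → ℝ) :
    energyNorm A cp D u ^ 2 = energyForm A cp D u u :=
  Real.sq_sqrt (hc.energyForm_nonneg hD u)

end Coefficients

/-- The energy on a subdomain may be computed with the gradient on the whole domain. -/
theorem energyForm_eq_setIntegral_jet (A : E d → Matrix (Fin d) (Fin d) ℝ) (cp : E d → ℝ)
    (hD : IsOpen D) (hD' : IsOpen D') (hsub : D' ⊆ D) (hu : u ∈ H1 D) {w : E d → ℝ}
    (hw : EqOn w u D') :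
    energyForm A cp D' w w
      = ∫ x in D', pointForm (A x) (cp x) (jet D u x) (jet D u x) := by
  rw [energyForm_eq_integral_jet]
  refine integral_congr_ae ?_
  filter_upwards [jet_mono_congr hD hD' hsub hu hw] with x hx
  rw [hx]

end Energy

/-! ### Finite overlap -/

theorem apply_sum_self_le_card_mul {V : Type*} [AddCommGroup V] [Module ℝ V]
    (b : LinearMap.BilinForm ℝ V) (hs : ∀ x y, b x y = b y x) (hb : ∀ x, 0 ≤ b x x)
    {κ : Type*} (s : Finset κ) (X : κ → V) :
    b (∑ k ∈ s, X k) (∑ k ∈ s, X k) ≤ s.card * ∑ k ∈ s, b (X k) (X k) := by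
  have h1 : ∀ k l, b (X k) (X l) ≤ (b (X k) (X k) + b (X l) (X l)) / 2 := by
    intro k l
    have h := hb (X k - X l)
    simp only [map_sub, LinearMap.sub_apply, hs (X l) (X k)] at h
    linarith
  calc b (∑ k ∈ s, X k) (∑ k ∈ s, X k)
      = ∑ k ∈ s, ∑ l ∈ s, b (X l) (X k) := by simp only [map_sum, LinearMap.sum_apply]
    _ ≤ ∑ k ∈ s, ∑ l ∈ s, (b (X l) (X l) + b (X k) (X k)) / 2 :=
        Finset.sum_le_sum fun k _ => Finset.sum_le_sum fun l _ => h1 l k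
    _ = s.card * ∑ k ∈ s, b (X k) (X k) := by
        simp only [← Finset.sum_div, Finset.sum_add_distrib, Finset.sum_const, nsmul_eq_mul,
          ← Finset.mul_sum]
        ring

namespace Decomposition

variable {d N : ℕ} {Ω : Set (E d)} {T : Triangulation Ω} {ι : Type*} {F : FESpace T ι}
  {A : E d → Matrix (Fin d) (Fin d) ℝ} {cp : E d → ℝ} {amax : ℝ}

theorem space_le_H1 (F : FESpace T ι) : F.space ≤ H1 Ω := fun _ ⟨_, h⟩ => h.memH10.1

theorem Vt_le_H1 (D : Decomposition F N) (j : Fin N) : D.Vt j ≤ H1 (D.sub j) := by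
  rintro _ ⟨u, hu, rfl⟩
  exact (space_le_H1 F hu).mono_congr T.isOpen.measurableSet (D.isOpen_sub j).measurableSet
    (D.sub_subset j) (fun x hx => indicator_of_mem hx u)

theorem V_eq_zero (D : Decomposition F N) (j : Fin N) {u : E d → ℝ} (hu : u ∈ D.V j) {x : E d}
    (hx : x ∉ D.sub j) : u x = 0 := by
  obtain ⟨w, -, rfl⟩ := hu.1
  exact indicator_of_notMem hx w

/-- The gradient of a function in `V_j` vanishes outside `Ω_j`, because up to a null set the
complement of `Ω_j` consists of the interiors of elements on which the function is zero. -/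
theorem ae_jet_eq_zero (D : Decomposition F N) (j : Fin N) {u : E d → ℝ} (hu : u ∈ D.V j) :
    ∀ᵐ x ∂(volume.restrict Ω), x ∉ D.sub j → jet Ω u x = 0 := by
  have huH := space_le_H1 F hu.2
  have h0 : ∀ t ∈ T.elems, t ∉ D.ext j → ∀ᵐ x ∂(volume : Measure (E d)),
      x ∈ interior (convexHull ℝ (t : Set (E d))) → jet Ω u x = 0 := by
    intro t ht htj
    rw [← ae_restrict_iff' isOpen_interior.measurableSet]
    have hz : EqOn 0 u (interior (convexHull ℝ (t : Set (E d)))) := fun x hx =>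
      (D.V_eq_zero j hu fun h => htj ((D.mem_sub_iff j ht hx).1 h)).symm
    have h1 := huH.isWeakGradient.mono_congr T.isOpen.measurableSet
      isOpen_interior.measurableSet (T.interior_subset t ht) hz
    filter_upwards [h1.ae_eq isOpen_interior (isWeakGradient_zero _),
      ae_restrict_mem isOpen_interior.measurableSet] with x hx hxt
    exact Prod.ext hx (hz hxt).symm
  have h1 : ∀ᵐ x ∂(volume.restrict Ω), ∀ t ∈ T.elems, t ∉ D.ext j →
      x ∈ interior (convexHull ℝ (t : Set (E d))) → jet Ω u x = 0 := by
    refine (ae_ball_iff T.elems.countable_toSet).2 fun t ht => ?_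
    by_cases htj : t ∈ D.ext j
    · simp [htj]
    · simpa [htj] using ae_restrict_of_ae (h0 t ht htj)
  filter_upwards [h1, T.ae_mem_interior] with x hx ⟨t, ht, hxt⟩ hxj
  exact hx t ht (fun h => hxj ((D.mem_sub_iff j ht hxt).2 h)) hxt

open scoped Classical in
/-- Sums of functions from the spaces `V_j` are stable up to the overlap `k₀`. -/
theorem energyForm_sum_le (D : Decomposition F N) (hc : Coefficients A cp amax Ω)
    (u : ∀ j, D.V j) :
    energyForm A cp Ω (∑ j, (u j : E d → ℝ)) (∑ j, (u j : E d → ℝ))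
      ≤ D.k0 * ∑ j, energyForm A cp (D.sub j) (u j) (u j) := by
  have hΩ := T.isOpen
  have huH : ∀ j, (u j : E d → ℝ) ∈ H1 Ω := fun j => space_le_H1 F (u j).2.2
  set f : Fin N → E d → ℝ := fun j x =>
    pointForm (A x) (cp x) (jet Ω (u j) x) (jet Ω (u j) x) with hf
  have hfi : ∀ j, IntegrableOn ((D.sub j).indicator (f j)) Ω := fun j =>
    (hc.integrable_pointForm hΩ (huH j) (huH j)).indicator (D.isOpen_sub j).measurableSet
  have hR : D.k0 * ∑ j, energyForm A cp (D.sub j) (u j) (u j)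
      = ∫ x in Ω, D.k0 * ∑ j, (D.sub j).indicator (f j) x := by
    rw [integral_const_mul, integral_finsetSum _ fun j _ => hfi j]
    congr 1
    refine Finset.sum_congr rfl fun j _ => ?_
    rw [setIntegral_indicator (D.isOpen_sub j).measurableSet,
      inter_eq_right.2 (D.sub_subset j)]
    exact energyForm_eq_setIntegral_jet A cp hΩ (D.isOpen_sub j) (D.sub_subset j) (huH j)
      fun x _ => rfl
  rw [hR, energyForm_eq_integral_jet]
  have hsum := (H1 Ω).sum_mem (t := Finset.univ) fun j _ => huH j
  refine integral_mono_ae (hc.integrable_pointForm hΩ hsum hsum)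
    ((integrable_finsetSum _ fun j _ => hfi j).const_mul _) ?_
  filter_upwards [jet_sum hΩ Finset.univ (fun j => (u j : E d → ℝ)) huH,
    ae_all_iff.2 fun j => D.ae_jet_eq_zero j (u j).2, T.ae_mem_interior,
    ae_restrict_mem hΩ.measurableSet] with x h1 h2 ⟨t, ht, hxt⟩ hx
  have e1 : jet Ω (∑ j, (u j : E d → ℝ)) x
      = ∑ j ∈ Finset.univ.filter (fun j => x ∈ D.sub j), jet Ω (u j) x := by
    rw [h1, Finset.sum_apply, Finset.sum_filter]
    refine Finset.sum_congr rfl fun j _ => ?_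
    split_ifs with h
    · rfl
    · exact h2 j h
  have e2 : ∑ j, (D.sub j).indicator (f j) x
      = ∑ j ∈ Finset.univ.filter (fun j => x ∈ D.sub j), f j x := by
    rw [Finset.sum_filter]; rfl
  change pointForm _ _ _ _ ≤ D.k0 * ∑ j, (D.sub j).indicator (f j) x
  rw [e1, e2]
  refine (apply_sum_self_le_card_mul _ (hc.pointForm_symm hx) (hc.pointForm_nonneg hx) _ _).trans
    ?_
  refine mul_le_mul_of_nonneg_right ?_
    (Finset.sum_nonneg fun j _ => hc.pointForm_nonneg hx _)
  exact_mod_cast D.card_filter_mem_sub_le ht hxt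

open scoped Classical in
/-- The local energies of a function on `Ω` add up to at most `k₀` times its energy. -/
theorem sum_energyForm_restr_le (D : Decomposition F N) (hc : Coefficients A cp amax Ω)
    {v : E d → ℝ} (hv : v ∈ F.space) :
    ∑ j, energyForm A cp (D.sub j) (D.restr j v hv) (D.restr j v hv)
      ≤ D.k0 * energyForm A cp Ω v v := by
  have hΩ := T.isOpen
  have hvH := space_le_H1 F hv
  set f : E d → ℝ := fun x => pointForm (A x) (cp x) (jet Ω v x) (jet Ω v x) with hf
  have hi : IntegrableOn f Ω := hc.integrable_pointForm hΩ hvH hvH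
  have hfi : ∀ j, IntegrableOn ((D.sub j).indicator f) Ω := fun j =>
    hi.indicator (D.isOpen_sub j).measurableSet
  have hL : ∑ j, energyForm A cp (D.sub j) (D.restr j v hv) (D.restr j v hv)
      = ∫ x in Ω, ∑ j, (D.sub j).indicator f x := by
    rw [integral_finsetSum _ fun j _ => hfi j]
    refine Finset.sum_congr rfl fun j _ => ?_
    rw [setIntegral_indicator (D.isOpen_sub j).measurableSet,
      inter_eq_right.2 (D.sub_subset j)]
    exact energyForm_eq_setIntegral_jet A cp hΩ (D.isOpen_sub j) (D.sub_subset j) hvH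
      fun x hx => indicator_of_mem hx v
  rw [hL, energyForm_eq_integral_jet, ← integral_const_mul]
  refine integral_mono_ae (integrable_finsetSum _ fun j _ => hfi j) (hi.const_mul _) ?_
  filter_upwards [T.ae_mem_interior, ae_restrict_mem hΩ.measurableSet] with x ⟨t, ht, hxt⟩ hx
  have e2 : ∑ j, (D.sub j).indicator f x
      = (Finset.univ.filter (fun j => x ∈ D.sub j)).card * f x := by
    rw [← nsmul_eq_mul, ← Finset.sum_const, Finset.sum_filter]; rfl
  rw [e2]
  refine mul_le_mul_of_nonneg_right ?_ (hc.pointForm_nonneg hx _)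
  exact_mod_cast D.card_filter_mem_sub_le ht hxt

/-! ### The coarse space estimate -/

theorem V_le_H1 (D : Decomposition F N) (j : Fin N) : D.V j ≤ H1 (D.sub j) :=
  inf_le_left.trans (D.Vt_le_H1 j)

/-- The local estimate: `v ∈ Ṽ_j` is approximated from the span of the first `m` eigenfunctions. -/
theorem exists_mem_span_energyForm_Xi_le [Fintype ι] (D : Decomposition F N)
    (hc : Coefficients A cp amax Ω) (j : Fin N)
    {p : Fin (Module.finrank ℝ (D.V j)) → D.Vt j} {lam : Fin (Module.finrank ℝ (D.V j)) → ℝ}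
    (hsys : D.IsEigensystem A cp j p lam) (m : Fin (Module.finrank ℝ (D.V j))) (v : D.Vt j) :
    ∃ z ∈ Submodule.span ℝ (p '' {l | l < m}),
      lam m * energyForm A cp (D.sub j) (D.Xi j (v - z)) (D.Xi j (v - z))
        ≤ energyForm A cp (D.sub j) v v := by
  obtain ⟨heig, hmono, hind⟩ := hsys
  have hO := D.isOpen_sub j
  have hcj := hc.mono (D.sub_subset j)
  set G := hcj.energyBilin hO
  have : Module.Finite ℝ (D.Vt j) := Module.Finite.of_basis (D.nodalBasis j)
  have : Module.Finite ℝ (D.V j) := Submodule.finiteDimensional_of_le (inf_le_left : D.V j ≤ _)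
  let iT := Submodule.inclusion (D.Vt_le_H1 j)
  let iX := Submodule.inclusion (D.V_le_H1 j) ∘ₗ D.Xi j
  -- The functions `Ξ_j p_l` form a basis of `V_j`, so `v` minus a combination of the `p_l` lies in
  -- the kernel of `Ξ_j`.
  have htop := hind.span_eq_top_of_card_eq_finrank' (by simp)
  obtain ⟨α, hα⟩ := (Submodule.mem_span_range_iff_exists_fun ℝ).1
    (htop ▸ Submodule.mem_top : D.Xi j v ∈ Submodule.span ℝ (range fun l => D.Xi j (p l)))
  have hker : iX (v - ∑ l, α l • p l) = 0 := by
    have : D.Xi j (v - ∑ l, α l • p l) = 0 := by simp [← hα]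
    simp [iX, this]
  exact exists_mem_span_mul_apply_sub_le (G.compl₁₂ iT iT) (G.compl₁₂ iX iX)
    (fun x y => hcj.energyForm_symm hO _ _) (fun x => hcj.energyForm_nonneg hO _)
    (fun x y => hcj.energyForm_symm hO _ _) (fun x => hcj.energyForm_nonneg hO _)
    p lam hmono (fun l w => (heig l).2 w) m α v
    (fun w => by rw [LinearMap.compl₁₂_apply, hker, map_zero, LinearMap.zero_apply])

theorem Xi_mem_coarseSpace [Fintype ι] (D : Decomposition F N)
    (p : ∀ j, Fin (Module.finrank ℝ (D.V j)) → D.Vt j) (m : Fin N → ℕ)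
    (hm : ∀ j, m j < Module.finrank ℝ (D.V j)) (j : Fin N) {z : D.Vt j}
    (hz : z ∈ Submodule.span ℝ (p j '' {l | l < ⟨m j, hm j⟩})) :
    (D.Xi j z : E d → ℝ) ∈ D.coarseSpace p m := by
  have : Submodule.span ℝ (p j '' {l | l < ⟨m j, hm j⟩})
      ≤ (D.coarseSpace p m).comap ((D.V j).subtype ∘ₗ D.Xi j) := by
    rw [Submodule.span_le]
    rintro _ ⟨l, hl, rfl⟩
    exact Submodule.subset_span ⟨j, l, hl, rfl⟩
  exact this hz

end Decomposition

end GenEO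

theorem mainTheorem8 {d N : ℕ} (hd : d = 2 ∨ d = 3) {Ω : Set (GenEO.E d)}
    (hΩ : IsOpen Ω) (hΩc : IsConnected Ω) (hΩb : Bornology.IsBounded Ω)
    (T : GenEO.Triangulation Ω) {ι : Type*} [Fintype ι] (F : GenEO.FESpace T ι)
    (D : GenEO.Decomposition F N)
    (A : GenEO.E d → Matrix (Fin d) (Fin d) ℝ) (amin amax : ℝ)
    (hA_meas : ∀ i k, AEStronglyMeasurable (fun x => A x i k) (volume.restrict Ω))
    (hA_symm : ∀ x ∈ Ω, (A x).IsSymm) (hamin : 0 < amin)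
    (hA_bound : ∀ x ∈ Ω, ∀ ξ : GenEO.E d,
      amin * ‖ξ‖ ^ 2 ≤ (A x).mulVec ξ.ofLp ⬝ᵥ ξ.ofLp ∧
        (A x).mulVec ξ.ofLp ⬝ᵥ ξ.ofLp ≤ amax * ‖ξ‖ ^ 2)
    (cp : GenEO.E d → ℝ) (hcp : MemLp cp ⊤ (volume.restrict Ω)) (hcp_nonneg : ∀ x ∈ Ω, 0 ≤ cp x)
    (p : ∀ j, Fin (Module.finrank ℝ (D.V j)) → D.Vt j)
    (lam : ∀ j, Fin (Module.finrank ℝ (D.V j)) → ℝ)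
    (hsys : ∀ j, D.IsEigensystem A cp j (p j) (lam j))
    (m : Fin N → ℕ) (hm_pos : ∀ j, 1 ≤ m j) (hm : ∀ j, m j < Module.finrank ℝ (D.V j))
    (hlam : ∀ j, 0 < lam j ⟨m j, hm j⟩)
    (v : GenEO.E d → ℝ) (hv : v ∈ F.space) :
    ⨅ z : D.coarseSpace p m, GenEO.energyNorm A cp Ω (v - (z : GenEO.E d → ℝ)) ^ 2
      ≤ (D.k0 : ℝ) ^ 2 * (⨅ j, lam j ⟨m j, hm j⟩)⁻¹ * GenEO.energyNorm A cp Ω v ^ 2 := by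
  have hc : GenEO.Coefficients A cp amax Ω := ⟨hA_meas, hA_symm, fun x hx ξ =>
    (by positivity : 0 ≤ amin * ‖ξ‖ ^ 2).trans (hA_bound x hx ξ).1,
    fun x hx ξ => (hA_bound x hx ξ).2, hcp, hcp_nonneg⟩
  -- `N ≥ 1`, so the infimum of the eigenvalues is attained: a point of `Ω` lies in an element, and
  -- an element lies in some subdomain.
  have : Nonempty (Fin N) := by
    obtain ⟨x, hx⟩ := hΩc.nonempty
    have h1 := subset_closure hx
    rw [← T.cover] at h1
    obtain ⟨t, ht, -⟩ := mem_iUnion₂.1 h1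
    obtain ⟨j, -⟩ := (D.core_cover t).1 ht
    exact ⟨j⟩
  set L := ⨅ j, lam j ⟨m j, hm j⟩
  have hL : 0 < L := by
    obtain ⟨j, hj⟩ := exists_eq_ciInf_of_finite (f := fun j => lam j ⟨m j, hm j⟩)
    exact (hlam j).trans_eq hj
  have hLle : ∀ j, L ≤ lam j ⟨m j, hm j⟩ := ciInf_le (Finite.bddBelow_range _)
  choose z hz hzle using fun j => D.exists_mem_span_energyForm_Xi_le hc j (hsys j) ⟨m j, hm j⟩
    (D.restr j v hv)
  have hz0 : ∑ j, (D.Xi j (z j) : GenEO.E d → ℝ) ∈ D.coarseSpace p m :=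
    Submodule.sum_mem _ fun j _ => D.Xi_mem_coarseSpace p m hm j (hz j)
  have hdiff : v - ∑ j, (D.Xi j (z j) : GenEO.E d → ℝ)
      = ∑ j, (D.Xi j (D.restr j v hv - z j) : GenEO.E d → ℝ) := by
    conv_lhs => rw [← D.sum_Xi_restr hv]
    simp [Finset.sum_sub_distrib]
  refine (ciInf_le ⟨0, ?_⟩ ⟨_, hz0⟩).trans ?_
  · rintro _ ⟨z, rfl⟩
    positivity
  rw [hc.energyNorm_sq hΩ, hc.energyNorm_sq hΩ]
  change GenEO.energyForm A cp Ω (v - ∑ j, (D.Xi j (z j) : GenEO.E d → ℝ))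
    (v - ∑ j, (D.Xi j (z j) : GenEO.E d → ℝ)) ≤ _
  rw [hdiff]
  calc _ ≤ _ := D.energyForm_sum_le hc fun j => D.Xi j (D.restr j v hv - z j)
    _ ≤ D.k0 * ∑ j, L⁻¹ * GenEO.energyForm A cp (D.sub j) (D.restr j v hv) (D.restr j v hv) := by
        gcongr with j
        rw [← div_eq_inv_mul, le_div_iff₀' hL]
        exact (mul_le_mul_of_nonneg_right (hLle j)
          ((hc.mono (D.sub_subset j)).energyForm_nonneg (D.isOpen_sub j) _)).trans (hzle j)
    _ = D.k0 * L⁻¹ *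
        ∑ j, GenEO.energyForm A cp (D.sub j) (D.restr j v hv) (D.restr j v hv) := by
        rw [← Finset.mul_sum, mul_assoc]
    _ ≤ D.k0 * L⁻¹ * (D.k0 * GenEO.energyForm A cp Ω v v) := by
        gcongr
        exact D.sum_energyForm_restr_le hc hv
    _ = (D.k0 : ℝ) ^ 2 * L⁻¹ * GenEO.energyForm A cp Ω v v := by ring
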